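/- Let $\mathcal{A}$ be a locally noetherian Grothendieck category, i.e. a Grothendieck category with a set of generators consisting of noetherian objects. A nonzero object $H$ of $\mathcal{A}$ is called \emph{monoform} if for every nonzero subobject $N$ of $H$ no nonzero subobject of $H$ is isomorphic to a subobject of $H/N$. Two monoform objects are \emph{atom-equivalent} if some nonzero subobject of one is isomorphic to a subobject of the other; this is an equivalence relation, and its classes are called \emph{atoms} in $\mathcal{A}$. Let $\alpha$ be an atom in $\mathcal{A}$. Every monoform object $H\in\alpha$ has an injective hull $E(H)$ (an injective object containing $H$ as an essential subobject), and the injective hulls of any two representatives of $\alpha$ are isomorphic; denote this object by $E(\alpha)$. Then $E(\alpha)$ has a unique maximal monoform subobject $H_\alpha$, called the \emph{atomic object} of $\alpha$. More precisely, let $J_\alpha$ be the set of all endomorphisms of $E(\alpha)$ that are not automorphisms; then $$H_\alpha=\bigcap_{f\in J_\alpha}\operatorname{Ker} f$$ is monoform, it contains every monoform subobject of $E(\alpha)$, and it is the only maximal element of the set of monoform subobjects of $E(\alpha)$. -/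

import Mathlib

open CategoryTheory CategoryTheory.Limits

universe w v u

/-- A Grothendieck category is locally noetherian if it has a (small) set of generators consisting
of noetherian objects. -/
class IsLocallyNoetherian (C : Type u) [Category.{v} C] [Abelian C] : Prop extends
    IsGrothendieckAbelian.{w} C where
  exists_noetherian_generators : ∃ P : ObjectProperty C,
    ObjectProperty.Small.{w} P ∧ P.IsSeparating ∧ ∀ X : C, P X → IsNoetherianObject X

section Atoms

variable {C : Type u} [Category.{v} C] [Abelian C]

/-- `X` and `Y` have a common nonzero subobject: some nonzero subobject of `X` is isomorphic to
a subobject of `Y`. -/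
def HaveCommonSubobject (X Y : C) : Prop :=
  ∃ (L : Subobject X) (L' : Subobject Y), L ≠ ⊥ ∧ Nonempty ((L : C) ≅ (L' : C))

/-- A nonzero object `H` is monoform if for every nonzero subobject `N` of `H`, the objects `H` and
`H / N` have no common nonzero subobject. -/
def IsMonoform (H : C) : Prop :=
  ¬ IsZero H ∧ ∀ N : Subobject H, N ≠ ⊥ → ¬ HaveCommonSubobject H (cokernel N.arrow)

theorem isZero_of_subobject_eq_bot {X : C} {L : Subobject X} (h : L = ⊥) : IsZero (L : C) := by
  subst h
  exact (isZero_zero C).of_iso Subobject.botCoeIsoZero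

theorem subobject_mk_ne_bot {X L : C} (i : L ⟶ X) [Mono i] (hL : ¬ IsZero L) :
    Subobject.mk i ≠ ⊥ :=
  fun h => hL ((isZero_of_subobject_eq_bot h).of_iso (Subobject.underlyingIso i).symm)

theorem haveCommonSubobject_iff {X Y : C} : HaveCommonSubobject X Y ↔
    ∃ (L : C) (i : L ⟶ X) (j : L ⟶ Y), ¬ IsZero L ∧ Mono i ∧ Mono j := by
  constructor
  · rintro ⟨L, L', hL, ⟨e⟩⟩
    refine ⟨(L : C), L.arrow, e.hom ≫ L'.arrow, fun h => hL ?_, inferInstance, inferInstance⟩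
    rw [← Subobject.mk_arrow L, Subobject.mk_eq_bot_iff_zero]
    exact h.eq_of_src _ _
  · rintro ⟨L, i, j, hL, _, _⟩
    exact ⟨Subobject.mk i, Subobject.mk j, subobject_mk_ne_bot i hL,
      ⟨Subobject.underlyingIso i ≪≫ (Subobject.underlyingIso j).symm⟩⟩

/-- Monoform objects are uniform. -/
theorem IsMonoform.not_isZero_pullback {H A B : C} (hH : IsMonoform H) (i : A ⟶ H) (j : B ⟶ H)
    [Mono i] [Mono j] (hA : ¬ IsZero A) (hB : ¬ IsZero B) : ¬ IsZero (pullback i j) := by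
  intro hz
  refine hH.2 (Subobject.mk i) (subobject_mk_ne_bot i hA) (haveCommonSubobject_iff.2
    ⟨B, j, j ≫ cokernel.π (Subobject.mk i).arrow, hB, inferInstance, ?_⟩)
  refine Preadditive.mono_of_cancel_zero _ fun {T} t ht => ?_
  have ht' : (t ≫ j) ≫ cokernel.π (Subobject.mk i).arrow = 0 := by simpa using ht
  let s : T ⟶ A := Abelian.monoLift (Subobject.mk i).arrow (t ≫ j) ht' ≫
    (Subobject.underlyingIso i).hom
  have hs : s ≫ i = t ≫ j := by
    simp [s]
  rw [← pullback.lift_snd s t hs, hz.eq_of_src (pullback.snd i j) 0, comp_zero]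

variable (C) in
/-- The monoform objects of `C`. -/
abbrev MonoformObject : Type u := { H : C // IsMonoform H }

variable (C) in
/-- Atom equivalence: having a common nonzero subobject. -/
instance atomSetoid : Setoid (MonoformObject C) where
  r H H' := HaveCommonSubobject H.1 H'.1
  iseqv :=
    { refl := fun H => haveCommonSubobject_iff.2
        ⟨H.1, 𝟙 _, 𝟙 _, H.2.1, inferInstance, inferInstance⟩
      symm := fun h => by
        obtain ⟨L, i, j, hL, hi, hj⟩ := haveCommonSubobject_iff.1 h
        exact haveCommonSubobject_iff.2 ⟨L, j, i, hL, hj, hi⟩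
      trans := fun {H₁ H₂ H₃} h h' => by
        obtain ⟨L, i, j, hL, hi, hj⟩ := haveCommonSubobject_iff.1 h
        obtain ⟨L', i', j', hL', hi', hj'⟩ := haveCommonSubobject_iff.1 h'
        exact haveCommonSubobject_iff.2 ⟨pullback j i', pullback.fst j i' ≫ i,
          pullback.snd j i' ≫ j', H₂.2.not_isZero_pullback j i' hL hL',
          inferInstance, inferInstance⟩ }

variable (C) in
/-- The atom spectrum of `C`: the quotient of the monoform objects by atom equivalence. -/
def ASpec : Type u := Quotient (atomSetoid C)

/-- `H` is a monoform object representing the atom `α`. -/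
def ASpec.Represents (α : ASpec C) (H : C) : Prop :=
  ∃ hH : IsMonoform H, Quotient.mk (atomSetoid C) ⟨H, hH⟩ = α

/-- A subobject `N` of `M` is essential if it meets every nonzero subobject of `M` nontrivially. -/
def IsEssentialSubobject {M : C} (N : Subobject M) : Prop :=
  ∀ L : Subobject M, L ≠ ⊥ → L ⊓ N ≠ ⊥

/-- `E` is an injective hull of `M`: it is injective and contains `M` as an essential subobject. -/
def IsInjectiveHull (M E : C) : Prop :=
  Injective E ∧ ∃ (i : M ⟶ E) (_ : Mono i), IsEssentialSubobject (Subobject.mk i)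

/-- `E` is (isomorphic to) the injective hull `E(α)` of the atom `α`, that is, the injective hull
of some monoform object representing `α`. -/
def ASpec.IsInjectiveHull (α : ASpec C) (E : C) : Prop :=
  ∃ H : C, α.Represents H ∧ _root_.IsInjectiveHull H E

/-- The intersection of the kernels of all endomorphisms of `E` that are not automorphisms. -/
noncomputable def interKerNonAut [IsGrothendieckAbelian.{w} C] (E : C) : Subobject E :=
  ⨅ f : { f : E ⟶ E // ¬ IsIso f }, kernelSubobject f.1

/-- `K` is monoform as an object of `C`. -/
def IsMonoformSubobject {E : C} (K : Subobject E) : Prop := IsMonoform (K : C)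

end Atoms

/-! Let `E` be an injective hull of a monoform `H`. As `H` is uniform, so is `E`: every nonzero
subobject is essential, hence every monic endomorphism is an automorphism. This makes hulls of
atom-equivalent objects isomorphic. Let `f` be a non-automorphism and `K` monoform in `E`. Were `f`
nonzero on `K`, its image there, a proper quotient of `K`, would meet `K` by uniformity, against
monoformity; so `K` lies in every such kernel (`IsMonoform.le_kernelSubobject`). Conversely, by
injectivity a failure of monoformity of the intersection of the kernels gives a non-automorphism not
vanishing on it (`IsMonoform.isMonoformSubobject_interKerNonAut`). Hulls exist by Zorn's lemma and
exactness of filtered colimits. -/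

section InjectiveHulls

/-! ### Essential monomorphisms -/

variable {C : Type u} [Category.{v} C]

/-- A monomorphism `i : M ⟶ E` is essential if a morphism out of `E` is a monomorphism as soon as
its composition with `i` is. -/
def EssentialMono {M E : C} (i : M ⟶ E) : Prop :=
  Mono i ∧ ∀ ⦃Z : C⦄ (f : E ⟶ Z), Mono (i ≫ f) → Mono f

/-- An essential monomorphism out of an injective object is an isomorphism. -/
theorem EssentialMono.isIso {X Y : C} [Injective X] {f : X ⟶ Y} (hf : EssentialMono f) :
    IsIso f := by
  have := hf.1
  have hr : f ≫ Injective.factorThru (𝟙 X) f = 𝟙 X := Injective.comp_factorThru _ _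
  have hmono : Mono (Injective.factorThru (𝟙 X) f) := hf.2 _ (by rw [hr]; infer_instance)
  exact ⟨_, hr, (cancel_mono (Injective.factorThru (𝟙 X) f)).1 (by simp [hr])⟩

theorem exists_comp_eq_of_mk_factors {X M T : C} {i : M ⟶ X} [Mono i] {t : T ⟶ X}
    (h : (Subobject.mk i).Factors t) : ∃ s : T ⟶ M, s ≫ i = t :=
  (Subobject.mk_factors_iff _ _).1 h

variable [Abelian C]

theorem eq_zero_of_factors_inf_eq_bot {X T : C} {A B : Subobject X} (h : A ⊓ B = ⊥) {t : T ⟶ X}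
    (hA : A.Factors t) (hB : B.Factors t) : t = 0 := by
  have := (Subobject.inf_factors t).2 ⟨hA, hB⟩
  rw [h] at this
  exact (Subobject.bot_factors_iff_zero _).1 this

theorem eq_bot_of_arrow_eq_zero {X : C} {L : Subobject X} (h : L.arrow = 0) : L = ⊥ := by
  rw [← Subobject.mk_arrow L, Subobject.mk_eq_bot_iff_zero]
  exact h

theorem kernelSubobject_ne_bot {X Y : C} {f : X ⟶ Y} (hf : ¬ Mono f) : kernelSubobject f ≠ ⊥ := by
  intro h
  refine hf (Preadditive.mono_of_cancel_zero _ fun {T} t ht => ?_)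
  have := (kernelSubobject_factors_iff f t).2 ht
  rw [h] at this
  exact (Subobject.bot_factors_iff_zero _).1 this

/-- Any test morphism into `Q` lifts to `X` after base change along `p`, which stays epi. -/
theorem mono_of_epi_comp {X Q Z : C} (p : X ⟶ Q) [Epi p] (f : Q ⟶ Z)
    (h : ∀ ⦃T : C⦄ (u : T ⟶ X), u ≫ p ≫ f = 0 → u ≫ p = 0) : Mono f := by
  refine Preadditive.mono_of_cancel_zero _ fun {T} t ht => ?_
  refine (cancel_epi (pullback.snd p t)).1 ?_
  rw [comp_zero, ← pullback.condition]
  refine h _ ?_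
  rw [← Category.assoc, pullback.condition, Category.assoc, ht, comp_zero]

theorem mono_cokernel_desc_kernelSubobject {X Y : C} (f : X ⟶ Y) :
    Mono (cokernel.desc (kernelSubobject f).arrow f (kernelSubobject_arrow_comp f)) := by
  refine mono_of_epi_comp (cokernel.π _) _ fun T u hu => ?_
  rw [cokernel.π_desc] at hu
  rw [← factorThruKernelSubobject_comp_arrow f u hu, Category.assoc, cokernel.condition,
    comp_zero]

theorem essentialMono_iff {M E : C} (i : M ⟶ E) [Mono i] :
    EssentialMono i ↔ IsEssentialSubobject (Subobject.mk i) := by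
  constructor
  · rintro ⟨_, h⟩ L hL hbot
    have : Mono (i ≫ cokernel.π L.arrow) := by
      refine Preadditive.mono_of_cancel_zero _ fun {T} t ht => ?_
      rw [← Category.assoc] at ht
      have h0 : t ≫ i = 0 := eq_zero_of_factors_inf_eq_bot hbot
        ((Subobject.factors_iff _ _).2
          ⟨Abelian.monoLift L.arrow (t ≫ i) ht, Abelian.monoLift_comp _ _ ht⟩)
        ((Subobject.mk_factors_iff _ _).2 ⟨t, rfl⟩)
      exact (cancel_mono i).1 (by rw [h0, zero_comp])
    have := h _ this
    exact hL (eq_bot_of_arrow_eq_zero ((cancel_mono (cokernel.π L.arrow)).1 (by simp)))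
  · intro h
    refine ⟨inferInstance, fun Z f hf => ?_⟩
    by_contra hmono
    refine h _ (kernelSubobject_ne_bot hmono) (eq_bot_of_arrow_eq_zero ?_)
    set K := kernelSubobject f ⊓ Subobject.mk i
    obtain ⟨s, hs⟩ := exists_comp_eq_of_mk_factors
      ((Subobject.inf_factors K.arrow).1 (Subobject.factors_self K)).2
    have hk := (kernelSubobject_factors_iff f K.arrow).1
      ((Subobject.inf_factors K.arrow).1 (Subobject.factors_self K)).1
    have : s = 0 := (cancel_mono (i ≫ f)).1 (by
      rw [zero_comp, ← Category.assoc, hs, hk])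
    rw [← hs, this]
    simp

theorem isInjectiveHull_iff {M E : C} :
    IsInjectiveHull M E ↔ Injective E ∧ ∃ i : M ⟶ E, EssentialMono i := by
  constructor
  · rintro ⟨hE, i, hi, h⟩
    exact ⟨hE, i, (essentialMono_iff i).2 h⟩
  · rintro ⟨hE, i, h⟩
    have := h.1
    exact ⟨hE, i, h.1, (essentialMono_iff i).1 h⟩

/-! ### Existence of injective hulls -/

section Grothendieck

variable [IsGrothendieckAbelian.{w} C]

/-- AB5: the supremum is a filtered colimit, and the map to `Y` is the colimit of monomorphisms into
the constant diagram at `Y`. -/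
theorem mono_iSup_arrow_comp {J : Type w} [Preorder J] [IsDirectedOrder J] [Nonempty J]
    {X Y : C} (S : J →o Subobject X) (f : X ⟶ Y) (h : ∀ j, Mono ((S j).arrow ≫ f)) :
    Mono ((⨆ j, S j).arrow ≫ f) := by
  have : IsFiltered.{w, w} J := inferInstance
  have := IsFiltered.isConnected J
  let F : J ⥤ MonoOver X :=
    { obj := fun j => MonoOver.mk (S j).arrow
      map := fun {j j'} g => MonoOver.homMk (Subobject.ofLE _ _ (S.monotone (leOfHom g))) }
  let c : Cocone (F ⋙ MonoOver.forget X) :=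
    { pt := Over.mk (⨆ j, S j).arrow
      ι := { app := fun j => Over.homMk (Subobject.ofLE _ _ (le_iSup S j))
             naturality := fun j j' g => Over.OverMorphism.ext (by
               change Subobject.ofLE _ _ _ ≫ Subobject.ofLE _ _ _ = Subobject.ofLE _ _ _ ≫ 𝟙 _
               simp) } }
  have : Mono c.pt.hom := inferInstanceAs (Mono (⨆ j, S j).arrow)
  have hc := IsGrothendieckAbelian.isColimitMapCoconeOfSubobjectMkEqISup F c (by
    change Subobject.mk (⨆ j, S j).arrow = ⨆ j, Subobject.mk (S j).arrow
    simp)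
  let α : F ⋙ MonoOver.forget _ ⋙ Over.forget _ ⟶ (Functor.const J).obj Y :=
    { app := fun j => (S j).arrow ≫ f
      naturality := fun j j' g => by
        change Subobject.ofLE _ _ _ ≫ (S j').arrow ≫ f = ((S j).arrow ≫ f) ≫ 𝟙 _
        simp }
  have : ∀ j, Mono (α.app j) := h
  have := NatTrans.mono_of_mono_app α
  refine colim.map_mono' α hc (isColimitConstCocone J Y) _ fun j => ?_
  change Subobject.ofLE _ _ _ ≫ (⨆ j, S j).arrow ≫ f = ((S j).arrow ≫ f) ≫ 𝟙 _
  simp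

/-- In a Grothendieck category, a morphism restricting to a monomorphism on every member of a
chain of subobjects restricts to a monomorphism on its supremum. -/
theorem mono_sSup_arrow_comp {X Y : C} {c : Set (Subobject X)} (hc : IsChain (· ≤ ·) c)
    (hne : c.Nonempty) (f : X ⟶ Y) (h : ∀ S ∈ c, Mono (S.arrow ≫ f)) :
    Mono ((sSup c).arrow ≫ f) := by
  let e := equivShrink.{w} c
  let : Preorder (Shrink.{w} c) := Preorder.lift e.symm
  have : Nonempty (Shrink.{w} c) := hne.to_subtype.map e
  have : IsDirectedOrder (Shrink.{w} c) := ⟨fun a b => by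
    rcases hc.total (e.symm a).2 (e.symm b).2 with hab | hab
    · exact ⟨b, hab, le_refl (e.symm b)⟩
    · exact ⟨a, le_refl (e.symm a), hab⟩⟩
  let S : Shrink.{w} c →o Subobject X := ⟨fun a => (e.symm a).1, fun a b hab => hab⟩
  have hS : sSup c = ⨆ a, S a := by
    rw [sSup_eq_iSup', ← e.symm.iSup_comp]
    rfl
  rw [hS]
  exact mono_iSup_arrow_comp S f fun a => h _ (e.symm a).2

/-- Every subobject of an object of a Grothendieck category becomes essential in some quotient of
it, the quotient by a maximal subobject meeting it trivially. -/
theorem exists_essentialMono_comp_cokernel {S X : C} (s : S ⟶ X) [Mono s] :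
    ∃ (Q : C) (p : X ⟶ Q), EssentialMono (s ≫ p) := by
  -- Trivial intersection with `s` is phrased as a monomorphism into its cokernel, so that it passes
  -- to suprema of chains.
  obtain ⟨L, -, hL⟩ := zorn_le_nonempty₀
    {L : Subobject X | Mono (L.arrow ≫ cokernel.π s)}
    (fun c hc hch L hL => ⟨sSup c, mono_sSup_arrow_comp.{w} hch ⟨L, hL⟩ _ hc,
      fun _ => le_sSup⟩) ⊥ (by
        have : IsZero ((⊥ : Subobject X) : C) := isZero_of_subobject_eq_bot rfl
        exact Preadditive.mono_of_cancel_zero _ fun t _ => this.eq_of_tgt _ _)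
  have hLmono : Mono (L.arrow ≫ cokernel.π s) := hL.prop
  refine ⟨_, cokernel.π L.arrow, ?_, fun Z f hf => ?_⟩
  · refine Preadditive.mono_of_cancel_zero _ fun {T} t ht => ?_
    rw [← Category.assoc] at ht
    have h1 := Abelian.monoLift_comp L.arrow (t ≫ s) ht
    have h2 : Abelian.monoLift L.arrow (t ≫ s) ht = 0 :=
      (cancel_mono (L.arrow ≫ cokernel.π s)).1 (by
        rw [← Category.assoc, h1]; simp)
    exact (cancel_mono s).1 (by rw [← h1, h2]; simp)
  · have hK : Mono ((kernelSubobject (cokernel.π L.arrow ≫ f)).arrow ≫ cokernel.π s) := by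
      refine Preadditive.mono_of_cancel_zero _ fun {T} t ht => ?_
      rw [← Category.assoc] at ht
      have h1 := Abelian.monoLift_comp s _ ht
      have h2 : Abelian.monoLift s _ ht = 0 :=
        (cancel_mono ((s ≫ cokernel.π L.arrow) ≫ f)).1 (by
          rw [Category.assoc, ← Category.assoc, h1, Category.assoc, kernelSubobject_arrow_comp]
          simp)
      exact (cancel_mono (kernelSubobject (cokernel.π L.arrow ≫ f)).arrow).1 (by
        rw [← h1, h2]; simp)
    have hle : kernelSubobject (cokernel.π L.arrow ≫ f) ≤ L :=
      hL.le_of_ge hK (le_kernelSubobject _ _ (by simp))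
    refine mono_of_epi_comp (cokernel.π L.arrow) f fun T u hu => ?_
    rw [← factorThruKernelSubobject_comp_arrow _ u hu, ← Subobject.ofLE_arrow hle,
      Category.assoc, Category.assoc, cokernel.condition, comp_zero, comp_zero]

/-- Every object of a Grothendieck category has an injective hull. -/
theorem exists_isInjectiveHull (H : C) : ∃ E : C, IsInjectiveHull H E := by
  let I := Injective.under H
  let i : H ⟶ I := Injective.ι H
  -- A maximal essential extension of `H` in `I`; essentiality is tested on maps out of `I`, so that
  -- one `f` serves a whole chain.
  obtain ⟨S, hiS, hS⟩ := zorn_le_nonempty₀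
    {S : Subobject I | ∀ ⦃Z : C⦄ (f : I ⟶ Z), Mono (i ≫ f) → Mono (S.arrow ≫ f)}
    (fun c hc hch L hL => ⟨sSup c, fun Z f hf =>
      mono_sSup_arrow_comp.{w} hch ⟨L, hL⟩ f fun S hS => hc hS f hf, fun _ => le_sSup⟩)
    (Subobject.mk i) (fun Z f hf => by
      rw [← Subobject.underlyingIso_hom_comp_eq_mk, Category.assoc]
      infer_instance)
  obtain ⟨Q, p, hp⟩ := exists_essentialMono_comp_cokernel.{w} S.arrow
  have := hp.1
  -- `Q` is an essential extension of `S` and embeds in `I` over it; maximality then makes `S` a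
  -- retract of `I`.
  let g : Q ⟶ I := Injective.factorThru S.arrow (S.arrow ≫ p)
  have hg : (S.arrow ≫ p) ≫ g = S.arrow := Injective.comp_factorThru _ _
  have : Mono g := hp.2 g (by rw [hg]; infer_instance)
  have hle : Subobject.mk g ≤ S := by
    refine hS.le_of_ge (fun Z f hf => ?_) ?_
    · have : Mono (g ≫ f) := hp.2 _ (by
        rw [← Category.assoc, hg]; exact hS.prop f hf)
      rw [← Subobject.underlyingIso_hom_comp_eq_mk, Category.assoc]
      infer_instance
    · exact Subobject.le_mk_of_comm (S.arrow ≫ p) hg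
  let r : Q ⟶ S := Subobject.ofMkLE g S hle
  have hr : S.arrow ≫ p ≫ r = 𝟙 _ := (cancel_mono S.arrow).1 (by
    simpa [r] using hg)
  refine ⟨S, isInjectiveHull_iff.2 ⟨?_, Subobject.ofMkLE i S hiS, inferInstance, fun Z f hf => ?_⟩⟩
  · exact Retract.injective ⟨S.arrow, p ≫ r, hr⟩
  -- Enlarging the target to an injective extends `f` to all of `I`.
  · let F : I ⟶ Injective.under Z := Injective.factorThru (f ≫ Injective.ι Z) S.arrow
    have hF : S.arrow ≫ F = f ≫ Injective.ι Z := Injective.comp_factorThru _ _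
    have : Mono (S.arrow ≫ F) := hS.prop F (by
      rw [← Subobject.ofMkLE_arrow hiS, Category.assoc, hF, ← Category.assoc]
      exact mono_comp _ _)
    rw [hF] at this
    exact mono_of_mono f (Injective.ι Z)

end Grothendieck

end InjectiveHulls

/-! ### Uniformity of the hull and the atomic object -/

section AtomicObject

variable {C : Type u} [Category.{v} C] [Abelian C]

/-- The injective hull of a monoform object is uniform. -/
theorem IsMonoform.inf_ne_bot_of_isInjectiveHull {H E : C} (hH : IsMonoform H)
    (hE : IsInjectiveHull H E) {A B : Subobject E} (hA : A ≠ ⊥) (hB : B ≠ ⊥) : A ⊓ B ≠ ⊥ := by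
  obtain ⟨_, i, _, hi⟩ := hE
  intro hbot
  have key : ∀ A : Subobject E, A ≠ ⊥ →
      ∃ (L : C) (a : L ⟶ H), Mono a ∧ ¬ IsZero L ∧ A.Factors (a ≫ i) := by
    intro A hA
    have hf := (Subobject.inf_factors _).1 (Subobject.factors_self (A ⊓ Subobject.mk i))
    obtain ⟨a, ha⟩ := exists_comp_eq_of_mk_factors hf.2
    have : Mono (a ≫ i) := by rw [ha]; infer_instance
    exact ⟨_, a, mono_of_mono a i,
      fun hz => hi A hA (eq_bot_of_arrow_eq_zero (hz.eq_of_src _ _)), by rw [ha]; exact hf.1⟩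
  obtain ⟨L, a, _, hL, ha⟩ := key A hA
  obtain ⟨L', b, _, hL', hb⟩ := key B hB
  refine hH.not_isZero_pullback a b hL hL' ?_
  have h0 : pullback.fst a b ≫ a ≫ i = 0 := by
    refine eq_zero_of_factors_inf_eq_bot hbot (Subobject.factors_of_factors_right _ ha) ?_
    rw [← Category.assoc, pullback.condition, Category.assoc]
    exact Subobject.factors_of_factors_right _ hb
  rw [IsZero.iff_id_eq_zero]
  exact (cancel_mono (pullback.fst a b ≫ a ≫ i)).1 (by rw [h0]; simp)

theorem IsMonoform.essentialMono_of_isInjectiveHull {H E L : C} (hH : IsMonoform H)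
    (hE : IsInjectiveHull H E) (hL : ¬ IsZero L) (a : L ⟶ E) [Mono a] : EssentialMono a :=
  (essentialMono_iff a).2 fun _ hA =>
    hH.inf_ne_bot_of_isInjectiveHull hE hA (subobject_mk_ne_bot a hL)

/-- The common subobject is essential in `E`, so extending its embedding into `E'` gives a
monomorphism `E ⟶ E'`, itself essential. -/
theorem nonempty_iso_of_isInjectiveHull {H H' E E' : C} (hH : IsMonoform H) (hH' : IsMonoform H')
    (h : HaveCommonSubobject H H') (hE : IsInjectiveHull H E) (hE' : IsInjectiveHull H' E') :
    Nonempty (E ≅ E') := by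
  obtain ⟨L, a, b, hL, _, _⟩ := haveCommonSubobject_iff.1 h
  obtain ⟨_, i, _, -⟩ := id hE
  obtain ⟨_, j, _, -⟩ := id hE'
  have hai := hH.essentialMono_of_isInjectiveHull hE hL (a ≫ i)
  let g : E ⟶ E' := Injective.factorThru (b ≫ j) (a ≫ i)
  have hg : (a ≫ i) ≫ g = b ≫ j := Injective.comp_factorThru _ _
  have : Mono g := hai.2 g (by rw [hg]; infer_instance)
  have hEz : ¬ IsZero E := fun hz => hL (hz.of_mono (a ≫ i))
  have := (hH'.essentialMono_of_isInjectiveHull hE' hEz g).isIso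
  exact ⟨asIso g⟩

theorem IsMonoform.isIso_of_mono {H E : C} (hH : IsMonoform H) (hE : IsInjectiveHull H E)
    (f : E ⟶ E) [Mono f] : IsIso f := by
  obtain ⟨_, i, _, -⟩ := id hE
  exact (hH.essentialMono_of_isInjectiveHull hE (fun hz => hH.1 (hz.of_mono i)) f).isIso

/-- A monoform subobject of the injective hull of a monoform object is killed by every
endomorphism which is not an automorphism. -/
theorem IsMonoform.le_kernelSubobject {H E : C} (hH : IsMonoform H) (hE : IsInjectiveHull H E)
    {K : Subobject E} (hK : IsMonoformSubobject K) {f : E ⟶ E} (hf : ¬ IsIso f) :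
    K ≤ kernelSubobject f := by
  have hmono : ¬ Mono f := fun _ => hf (hH.isIso_of_mono hE f)
  have huni : ∀ {A B : Subobject E}, A ≠ ⊥ → B ≠ ⊥ → A ⊓ B ≠ ⊥ :=
    hH.inf_ne_bot_of_isInjectiveHull hE
  refine Limits.le_kernelSubobject _ _ ?_
  by_contra h0
  have hKb : K ≠ ⊥ := fun h => hK.1 (isZero_of_subobject_eq_bot h)
  let k : (K : C) ⟶ E := K.arrow ≫ f
  have hkm : ¬ Mono k := fun h => hmono
    ((hH.essentialMono_of_isInjectiveHull hE hK.1 K.arrow).2 f h)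
  let m := cokernel.desc (kernelSubobject k).arrow k (kernelSubobject_arrow_comp k)
  have : Mono m := mono_cokernel_desc_kernelSubobject k
  have him : ¬ IsZero (cokernel (kernelSubobject k).arrow) := fun hz => h0 (by
    change k = 0
    rw [← cokernel.π_desc (kernelSubobject k).arrow k (kernelSubobject_arrow_comp k),
      hz.eq_of_tgt (cokernel.π (kernelSubobject k).arrow) 0, zero_comp])
  -- The common subobject is the intersection of `K` with the image of `k`.
  exact hK.2 (kernelSubobject k) (kernelSubobject_ne_bot hkm) (haveCommonSubobject_iff.2
    ⟨_, Subobject.ofLE _ K inf_le_right,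
      Subobject.ofLE _ _ inf_le_left ≫ (Subobject.underlyingIso m).hom,
      fun hz => huni (subobject_mk_ne_bot m him) hKb
        (eq_bot_of_arrow_eq_zero (hz.eq_of_src _ _)), inferInstance, inferInstance⟩)

theorem IsMonoform.of_iso {H H' : C} (hH : IsMonoform H) (e : H ≅ H') : IsMonoform H' := by
  refine ⟨fun hz => hH.1 (hz.of_iso e), fun N hN hcom => ?_⟩
  obtain ⟨L, a, b, hL, _, _⟩ := haveCommonSubobject_iff.1 hcom
  have hNz : ¬ IsZero (N : C) := fun hz => hN (eq_bot_of_arrow_eq_zero (hz.eq_of_src _ _))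
  let c : cokernel N.arrow ≅ cokernel (Subobject.mk (N.arrow ≫ e.inv)).arrow :=
    cokernel.mapIso _ _ (Subobject.underlyingIso (N.arrow ≫ e.inv)).symm e.symm (by simp)
  exact hH.2 _ (subobject_mk_ne_bot (N.arrow ≫ e.inv) hNz) (haveCommonSubobject_iff.2
    ⟨L, a ≫ e.inv, b ≫ c.hom, hL, inferInstance, inferInstance⟩)

variable [IsGrothendieckAbelian.{w} C]

theorem IsMonoform.le_interKerNonAut {H E : C} (hH : IsMonoform H) (hE : IsInjectiveHull H E)
    {K : Subobject E} (hK : IsMonoformSubobject K) : K ≤ interKerNonAut.{w} E :=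
  le_iInf fun f => hH.le_kernelSubobject hE hK f.2

theorem IsMonoform.isMonoformSubobject_interKerNonAut {H E : C} (hH : IsMonoform H)
    (hE : IsInjectiveHull H E) : IsMonoformSubobject (interKerNonAut.{w} E) := by
  obtain ⟨_, i, _, -⟩ := id hE
  have hle := hH.le_interKerNonAut.{w} hE
    (K := Subobject.mk i) (hH.of_iso (Subobject.underlyingIso i).symm)
  set M := interKerNonAut.{w} E with hM
  refine ⟨fun hz => hH.1 (hz.of_mono (Subobject.ofMkLE i M hle)), fun N hN hcom => ?_⟩
  obtain ⟨L, a, b, hL, _, _⟩ := haveCommonSubobject_iff.1 hcom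
  let g : cokernel N.arrow ⟶ E := Injective.factorThru (a ≫ M.arrow) b
  have hg : b ≫ g = a ≫ M.arrow := Injective.comp_factorThru _ _
  let h : E ⟶ E := Injective.factorThru (cokernel.π N.arrow ≫ g) M.arrow
  have hh : M.arrow ≫ h = cokernel.π N.arrow ≫ g := Injective.comp_factorThru _ _
  -- `h` kills `N`, because on `M` it factors through `M / N`.
  have hnot : ¬ IsIso h := fun _ => hN (eq_bot_of_arrow_eq_zero
    ((cancel_mono (M.arrow ≫ h)).1 (by rw [hh]; simp)))
  have hMh : M ≤ kernelSubobject h := iInf_le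
    (fun f : { f : E ⟶ E // ¬ IsIso f } => kernelSubobject f.1) ⟨h, hnot⟩
  have h0 : M.arrow ≫ h = 0 := by
    rw [← Subobject.ofLE_arrow hMh, Category.assoc, kernelSubobject_arrow_comp, comp_zero]
  have hg0 : g = 0 := (cancel_epi (cokernel.π N.arrow)).1 (by rw [← hh, h0, comp_zero])
  rw [hg0, comp_zero] at hg
  exact hL ((IsZero.iff_id_eq_zero L).2 ((cancel_mono (a ≫ M.arrow)).1 (by simp [← hg])))

end AtomicObject

theorem mainTheorem5 {C : Type u} [Category.{v} C] [Abelian C] [IsLocallyNoetherian.{w} C]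
    (α : ASpec C) :
    (∀ H : C, α.Represents H → ∃ E : C, IsInjectiveHull H E) ∧
    (∀ E E' : C, α.IsInjectiveHull E → α.IsInjectiveHull E' → Nonempty (E ≅ E')) ∧
    ∀ E : C, α.IsInjectiveHull E →
      (∃! K : Subobject E, Maximal IsMonoformSubobject K) ∧
      Maximal IsMonoformSubobject (interKerNonAut.{w} E) ∧
      ∀ K : Subobject E, IsMonoformSubobject K → K ≤ interKerNonAut.{w} E := by
  refine ⟨fun H _ => exists_isInjectiveHull.{w} H, ?_, ?_⟩
  · rintro E E' ⟨H, ⟨hH, rfl⟩, hE⟩ ⟨H', ⟨hH', h⟩, hE'⟩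
    exact nonempty_iso_of_isInjectiveHull hH hH' (Quotient.exact h.symm) hE hE'
  · rintro E ⟨H, ⟨hH, rfl⟩, hE⟩
    have hle : ∀ K : Subobject E, IsMonoformSubobject K → K ≤ interKerNonAut.{w} E :=
      fun K hK => hH.le_interKerNonAut.{w} hE hK
    have hmax : Maximal IsMonoformSubobject (interKerNonAut.{w} E) :=
      ⟨hH.isMonoformSubobject_interKerNonAut.{w} hE, fun K hK _ => hle K hK⟩
    exact ⟨⟨_, hmax, fun K hK => hK.eq_of_le hmax.prop (hle K hK.prop)⟩, hmax, hle⟩
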